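/- **Proposition 3.3.** Let $G$ be a discrete group that admits an amenable action. Let $\theta : G\times G\to\mathbb T=\{c\in\mathbb C:|c|=1\}$ be a normalized 2-cocycle, i.e. $\theta(1,g)=\theta(g,1)=1$ and $\theta(g,h)\theta(gh,k)=\theta(h,k)\theta(g,hk)$ for all $g,h,k\in G$, and let $\gamma\in\mathrm{Aut}(G)$ satisfy $\theta(\gamma(g),\gamma(h))=\theta(g,h)$ for all $g,h\in G$. Let $C_r^*(G,\theta)\subseteq B(\ell^2(G))$ be the $C^*$-algebra generated by the unitaries $\lambda^\theta_s\xi_g=\theta(s,g)\xi_{sg}$ ($s\in G$), where $(\xi_g)_{g\in G}$ is the canonical orthonormal basis, and let $\hat\gamma$ be the $*$-automorphism of $C^*_r(G,\theta)$ with $\hat\gamma(\lambda^\theta_g)=\lambda^\theta_{\gamma(g)}$. Then $$ht(\hat\gamma)\le ha(\gamma)\quad\text{in }[-\infty,\infty].$$ Here the terms are as follows. *Amenable actions.* Let $\alpha:G\to\mathrm{Aut}(A)$ be an action on a nonzero unital commutative $C^*$-algebra $A$. The space $\ell^1(G,A)$ is the completion of the finitely supported functions $T:G\to A$ in the norm $\|T\|_1=\big\|\sum_g|T(g)|\big\|_A$,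 and $(s.T)(g)=\alpha_s(T(s^{-1}g))$. The action is *amenable* if there are finitely supported $T_n\ge0$ with $\sum_gT_n(g)=1_A$ and $\|s.T_n-T_n\|_1\to0$ for every $s\in G$. *Dual entropy.* For finite $\omega\subset G$ and $\delta>0$ let $ra(\omega,\delta)$ be the infimum of $|\mathrm{supp}(T)|$ over all amenable actions $\alpha:G\to\mathrm{Aut}(A)$ as above and all nonnegative $T\in\ell^1(G,A)$ with $\sum_gT(g)=1_A$ and $\|s.T-T\|_1<\delta$ for all $s\in\omega$. Then $$ha(\gamma)=\sup_{\omega}\,\sup_{\delta>0}\,\limsup_{n\to\infty}\frac1n\log ra\big(\omega\cup\gamma(\omega)\cup\dots\cup\gamma^{n-1}(\omega),\delta\big),$$ where $\omega$ runs over the finite subsets of $G$. *Brown's entropy.* Let $A$ be a $C^*$-algebra with a faithful representation $\pi:A\to B(H)$. For finite $\omega\subset A$ and $\delta>0$ let $rcp(\pi,\omega,\delta)$ be the infimum of $\mathrm{rank}(B)$ (the dimension of a maximal abelian $*$-subalgebra of $B$) over all finite-dimensional $C^*$-algebras $B$ for which there are contractive completely positive maps $\varphi:A\to B$, $\psi:B\to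 B(H)$ with $\|\psi(\varphi(x))-\pi(x)\|<\delta$ for all $x\in\omega$. For $\beta\in\mathrm{Aut}(A)$, $$ht(\beta)=\sup_{\omega}\,\sup_{\delta>0}\,\limsup_{n\to\infty}\frac1n\log rcp\big(\pi,\omega\cup\beta(\omega)\cup\dots\cup\beta^{n-1}(\omega),\delta\big),$$ where $\omega$ runs over the finite subsets of $A$ (and $\log0=-\infty$). This does not depend on the choice of $\pi$; for $A=C_r^*(G,\theta)$ we take $\pi$ to be the inclusion $C_r^*(G,\theta)\subseteq B(\ell^2(G))$. -/

import Mathlib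

open Filter Topology
open scoped ENNReal CStarAlgebra

noncomputable section

namespace DualEntropy

universe u

/-! ## Entropy built from a rank function (Voiculescu's approximation approach) -/

/-- `ω ∪ f(ω) ∪ ⋯ ∪ f^{n-1}(ω)`. -/
def orbitUnion {X : Type*} (f : X → X) (ω : Set X) (n : ℕ) : Set X :=
  ⋃ k ∈ Finset.range n, f^[k] '' ω

/-- For a rank function `r(ω, δ)` of a subset `ω ⊆ X` and a tolerance `δ`, and a map `f : X → X`,
`sup_ω sup_{δ > 0} limsup_n (1/n) log r(ω ∪ f(ω) ∪ ⋯ ∪ f^{n-1}(ω), δ)`,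
where `ω` runs over the finite subsets of `X`. Here `log 0 = -∞` and `log ∞ = ∞`. -/
def approximationEntropy {X : Type*} (r : Set X → ℝ → ℕ∞) (f : X → X) : EReal :=
  ⨆ (ω : Finset X) (δ : ℝ) (_ : 0 < δ),
    limsup (fun n : ℕ => ENNReal.log ((r (orbitUnion f (ω : Set X) n) δ : ℕ∞) : ℝ≥0∞) / (n : EReal))
      atTop

/-! ## Amenable actions and the dual entropy of a group automorphism -/

section Actions

variable {G : Type*} [Group G] {A : Type*} [CommCStarAlgebra A] [PartialOrder A]
  [StarOrderedRing A]

/-- Membership in `ℓ¹(G, A)`, the completion of the finitely supported functions in the norm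
`‖∑_g |T(g)|‖`. By the Cauchy criterion this is unconditional norm convergence of
`∑_g |T(g)|`. -/
def MemL1 (T : G → A) : Prop := Summable fun g => CFC.abs (T g)

/-- The norm `‖T‖₁ = ‖∑_g |T(g)|‖` of `T ∈ ℓ¹(G, A)`. -/
def l1Norm (T : G → A) : ℝ := ‖∑' g, CFC.abs (T g)‖

/-- The translate `(s.T)(g) = α_s(T(s⁻¹ g))`. -/
def translate (α : G →* (A ≃⋆ₐ[ℂ] A)) (s : G) (T : G → A) : G → A :=
  fun g => α s (T (s⁻¹ * g))

/-- A nonnegative `T ∈ ℓ¹(G, A)` with `∑_g T(g) = 1`. -/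
structure IsNormalized (T : G → A) : Prop where
  memL1 : MemL1 T
  nonneg : ∀ g, 0 ≤ T g
  hasSum : HasSum T 1

/-- Amenability of an action of the discrete group `G` on a unital commutative C⋆-algebra. -/
def IsAmenableAction (α : G →* (A ≃⋆ₐ[ℂ] A)) : Prop :=
  ∃ T : ℕ → G → A,
    (∀ n, IsNormalized (T n) ∧ (Function.support (T n)).Finite) ∧
    ∀ s : G, Tendsto (fun n => l1Norm (translate α s (T n) - T n)) atTop (𝓝 0)

/-- The amenable `δ`-rank of `ω` with respect to the action `α`. -/
def actionRank (α : G →* (A ≃⋆ₐ[ℂ] A)) (ω : Set G) (δ : ℝ) : ℕ∞ :=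
  sInf {N : ℕ∞ | ∃ T : G → A, IsNormalized T ∧ (∀ s ∈ ω, l1Norm (translate α s T - T) < δ) ∧
    N = (Function.support T).encard}

end Actions

/-- The discrete group `G` admits an amenable action on a nonzero unital commutative C⋆-algebra
(equivalently, on a nonempty compact space). -/
def AdmitsAmenableAction (G : Type u) [Group G] : Prop :=
  ∃ (A : Type u) (_ : CommCStarAlgebra A) (_ : PartialOrder A) (_ : StarOrderedRing A)
    (_ : Nontrivial A) (α : G →* (A ≃⋆ₐ[ℂ] A)), IsAmenableAction α

/-- The amenable `δ`-rank of `ω`: the infimum of the ranks with respect to `α`, over all amenable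
actions `α` of `G` on nonzero unital commutative C⋆-algebras. -/
def amenableRank {G : Type u} [Group G] (ω : Set G) (δ : ℝ) : ℕ∞ :=
  sInf {N : ℕ∞ | ∃ (A : Type u) (_ : CommCStarAlgebra A) (_ : PartialOrder A)
    (_ : StarOrderedRing A) (_ : Nontrivial A) (α : G →* (A ≃⋆ₐ[ℂ] A)),
    IsAmenableAction α ∧ N = actionRank α ω δ}

/-- The dual entropy `ha(γ)` of an automorphism `γ` of the discrete group `G`. -/
def dualEntropy {G : Type u} [Group G] (γ : G ≃* G) : EReal :=
  approximationEntropy (amenableRank (G := G)) γ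

/-! ## Brown's noncommutative topological entropy -/

/-- Maximal abelian `*`-subalgebras. -/
def IsMaximalAbelian {B : Type*} [CStarAlgebra B] (S : StarSubalgebra ℂ B) : Prop :=
  Maximal (fun S : StarSubalgebra ℂ B => ∀ x ∈ S, ∀ y ∈ S, x * y = y * x) S

/-- The rank of a finite-dimensional C⋆-algebra: the dimension of a maximal abelian
`*`-subalgebra (they all have the same dimension). -/
def cstarRank (B : Type*) [CStarAlgebra B] : ℕ :=
  sInf {d : ℕ | ∃ S : StarSubalgebra ℂ B, IsMaximalAbelian S ∧ d = Module.finrank ℂ S}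

section Brown

variable {A : Type*} [CStarAlgebra A] [PartialOrder A] [StarOrderedRing A]
  {H : Type*} [NormedAddCommGroup H] [InnerProductSpace ℂ H] [CompleteSpace H]

/-- The completely positive `δ`-rank `rcp(π, ω, δ)`, for a faithful representation
`π : A → B(H)`: the least rank of a finite-dimensional C⋆-algebra `B` for which there are
contractive completely positive maps `φ : A → B` and `ψ : B → B(H)` with
`‖ψ(φ(x)) - π(x)‖ < δ` for all `x ∈ ω` (and `∞` if there is none). -/
def rcp (π : A →⋆ₐ[ℂ] (H →L[ℂ] H)) (ω : Set A) (δ : ℝ) : ℕ∞ :=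
  sInf {N : ℕ∞ | ∃ (B : Type) (_ : CStarAlgebra B) (_ : PartialOrder B) (_ : StarOrderedRing B)
    (_ : FiniteDimensional ℂ B) (φ : A →CP B) (ψ : B →CP (H →L[ℂ] H)),
    (∀ a, ‖φ a‖ ≤ ‖a‖) ∧ (∀ b, ‖ψ b‖ ≤ ‖b‖) ∧ (∀ x ∈ ω, ‖ψ (φ x) - π x‖ < δ) ∧
    N = (cstarRank B : ℕ∞)}

/-- Brown's noncommutative topological entropy `ht(π, a)` of a `*`-automorphism `a` of `A`, formed
with the faithful representation `π` of `A`. -/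
def brownEntropy (π : A →⋆ₐ[ℂ] (H →L[ℂ] H)) (a : A ≃⋆ₐ[ℂ] A) : EReal :=
  approximationEntropy (rcp π) a

end Brown

/-! ## Reduced twisted group C⋆-algebras -/

section Twisted

variable {G : Type*} [Group G]

/-- Normalized `𝕋`-valued `2`-cocycles. -/
structure IsCocycle (θ : G → G → Circle) : Prop where
  one_left : ∀ g, θ 1 g = 1
  one_right : ∀ g, θ g 1 = 1
  cocycle : ∀ g h k, θ g h * θ (g * h) k = θ h k * θ g (h * k)

/-- The Hilbert space `ℓ²(G)`. -/
abbrev L2 (G : Type*) : Type _ := lp (fun _ : G => ℂ) 2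

/-- The canonical orthonormal basis vector `ξ_g` of `ℓ²(G)`. -/
def basisVec {G : Type*} (g : G) : L2 G := by
  classical exact lp.single 2 g (1 : ℂ)

theorem memℓp_monomial {G : Type*} (σ : Equiv.Perm G) (c : G → Circle) (f : L2 G) :
    Memℓp (fun h => (c h : ℂ) * f (σ h)) 2 := by
  have h2 : (0 : ℝ) < (2 : ℝ≥0∞).toReal := by norm_num
  have := (memℓp_gen_iff h2).1 (lp.memℓp f)
  refine (memℓp_gen_iff h2).2 ?_
  simpa [Function.comp_def, Circle.norm_coe] using (σ.summable_iff).2 this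

/-- The unitary `ξ_g ↦ c(g) ξ_{σ(g)}` of `ℓ²(G)`. -/
def monomialUnitary {G : Type*} (σ : Equiv.Perm G) (c : G → Circle) : L2 G ≃ₗᵢ[ℂ] L2 G where
  toFun f := ⟨fun h => (c (σ.symm h) : ℂ) * f (σ.symm h),
    memℓp_monomial σ.symm (fun h => c (σ.symm h)) f⟩
  invFun f := ⟨fun h => ((c h)⁻¹ : Circle) * f (σ h), memℓp_monomial σ (fun h => (c h)⁻¹) f⟩
  map_add' f g := by
    ext h
    exact mul_add _ _ _
  map_smul' a f := by
    ext h
    simp [mul_left_comm]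
  left_inv f := by
    ext h
    simp
  right_inv f := by
    ext h
    simp
  norm_map' f := by
    have h2 : (0 : ℝ) < (2 : ℝ≥0∞).toReal := by norm_num
    rw [lp.norm_eq_tsum_rpow h2, lp.norm_eq_tsum_rpow h2]
    congr 1
    simpa [Circle.norm_coe] using σ.symm.tsum_eq (fun h => ‖f h‖ ^ (2 : ℝ≥0∞).toReal)

theorem monomialUnitary_apply {G : Type*} (σ : Equiv.Perm G) (c : G → Circle) (f : L2 G) (h : G) :
    monomialUnitary σ c f h = (c (σ.symm h) : ℂ) * f (σ.symm h) := rfl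

theorem monomialUnitary_symm_apply {G : Type*} (σ : Equiv.Perm G) (c : G → Circle) (f : L2 G)
    (h : G) : (monomialUnitary σ c).symm f h = ((c h)⁻¹ : Circle) * f (σ h) := rfl

theorem monomialUnitary_basisVec {G : Type*} (σ : Equiv.Perm G) (c : G → Circle) (g : G) :
    monomialUnitary σ c (basisVec g) = (c g : ℂ) • basisVec (σ g) := by
  classical
  ext h
  by_cases hg : σ.symm h = g
  · subst hg
    simp [monomialUnitary, basisVec]
  · have : h ≠ σ g := fun e => hg (by simp [e])
    simp [monomialUnitary, basisVec, hg, this]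

/-- The unitary `λ^θ_s : ξ_g ↦ θ(s, g) ξ_{sg}`. -/
def twistedTranslation (θ : G → G → Circle) (s : G) : L2 G ≃ₗᵢ[ℂ] L2 G :=
  monomialUnitary (Equiv.mulLeft s) (θ s)

/-- `λ^θ_s` as a bounded operator on `ℓ²(G)`. -/
def lam (θ : G → G → Circle) (s : G) : L2 G →L[ℂ] L2 G :=
  ((twistedTranslation θ s : L2 G ≃L[ℂ] L2 G) : L2 G →L[ℂ] L2 G)

theorem lam_basisVec (θ : G → G → Circle) (s g : G) :
    lam θ s (basisVec g) = (θ s g : ℂ) • basisVec (s * g) :=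
  monomialUnitary_basisVec _ _ _

/-- The reduced twisted group C⋆-algebra `C⋆_r(G, θ)`: the C⋆-algebra of operators on `ℓ²(G)`
generated by the unitaries `λ^θ_s`, `s ∈ G`. -/
def reducedAlgebra (θ : G → G → Circle) : StarSubalgebra ℂ (L2 G →L[ℂ] L2 G) :=
  (StarAlgebra.adjoin ℂ (Set.range (lam θ))).topologicalClosure

instance isClosed_reducedAlgebra (θ : G → G → Circle) :
    IsClosed (reducedAlgebra θ : Set (L2 G →L[ℂ] L2 G)) :=
  StarSubalgebra.isClosed_topologicalClosure _

theorem exists_eq_star_mul_self {A : Type*} [CStarAlgebra A] (x : A) (hx : IsSelfAdjoint x)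
    (h : ∀ t : ℝ, (t : ℂ) ∈ spectrum ℂ x → 0 ≤ t) : ∃ s, x = star s * s := by
  let _ : PartialOrder A := CStarAlgebra.spectralOrder A
  have _ : StarOrderedRing A := CStarAlgebra.spectralOrderedRing A
  refine CStarAlgebra.nonneg_iff_eq_star_mul_self.1 ?_
  rw [StarOrderedRing.nonneg_iff_spectrum_nonneg (R := ℝ) x (ha := hx)]
  exact fun t ht => h t ((spectrum.algebraMap_mem_iff ℂ).2 ht)

theorem starOrderedRing_of_isClosed {A : Type*} [CStarAlgebra A] [PartialOrder A]
    [StarOrderedRing A] (S : StarSubalgebra ℂ A) [IsClosed (S : Set A)] : StarOrderedRing S := by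
  refine StarOrderedRing.of_nonneg_iff' (fun {x y} hxy z => ?_) fun x => ⟨fun hx => ?_, ?_⟩
  · exact add_le_add_right (α := A) hxy z
  · have hx' : 0 ≤ (x : A) := hx
    refine exists_eq_star_mul_self x (Subtype.ext (IsSelfAdjoint.of_nonneg hx').star_eq)
      fun t ht => ?_
    rw [StarSubalgebra.spectrum_eq (S := S)] at ht
    exact spectrum_nonneg_of_nonneg hx' ((spectrum.algebraMap_mem_iff ℂ).1 ht)
  · rintro ⟨s, rfl⟩
    exact star_mul_self_nonneg (s : A)

instance starOrderedRing_reducedAlgebra (θ : G → G → Circle) :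
    StarOrderedRing (reducedAlgebra θ) :=
  starOrderedRing_of_isClosed _

theorem lam_mem (θ : G → G → Circle) (s : G) : lam θ s ∈ reducedAlgebra θ :=
  StarSubalgebra.le_topologicalClosure _ (StarAlgebra.subset_adjoin ℂ _ ⟨s, rfl⟩)

/-- `λ^θ_s` as an element of `C⋆_r(G, θ)`. -/
def lamElt (θ : G → G → Circle) (s : G) : reducedAlgebra θ := ⟨lam θ s, lam_mem θ s⟩

/-- The unitary `ξ_g ↦ ξ_{γ(g)}`. -/
def autUnitary (γ : G ≃* G) : L2 G ≃ₗᵢ[ℂ] L2 G := monomialUnitary γ.toEquiv fun _ => 1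

theorem conj_lam (θ : G → G → Circle) (γ : G ≃* G) (hγ : ∀ g h, θ (γ g) (γ h) = θ g h) (s : G) :
    (autUnitary γ).conjStarAlgEquiv (lam θ s) = lam θ (γ s) := by
  ext f h
  have := hγ s (s⁻¹ * γ.symm h)
  simp at this
  simp [autUnitary, lam, twistedTranslation, monomialUnitary_apply, monomialUnitary_symm_apply,
    this]

theorem conj_symm_lam (θ : G → G → Circle) (γ : G ≃* G) (hγ : ∀ g h, θ (γ g) (γ h) = θ g h)
    (s : G) : (autUnitary γ).conjStarAlgEquiv.symm (lam θ s) = lam θ (γ.symm s) := by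
  rw [StarAlgEquiv.symm_apply_eq, conj_lam θ γ hγ, MulEquiv.apply_symm_apply]

theorem reducedAlgebra_mapsTo (θ : G → G → Circle)
    (Φ : (L2 G →L[ℂ] L2 G) →⋆ₐ[ℂ] (L2 G →L[ℂ] L2 G)) (hΦ : Continuous Φ)
    (h : ∀ s, Φ (lam θ s) ∈ reducedAlgebra θ) {x : L2 G →L[ℂ] L2 G} (hx : x ∈ reducedAlgebra θ) :
    Φ x ∈ reducedAlgebra θ := by
  have hle : reducedAlgebra θ ≤ (reducedAlgebra θ).comap Φ := by
    refine StarSubalgebra.topologicalClosure_minimal ?_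
      ((isClosed_reducedAlgebra θ).preimage hΦ)
    rw [StarAlgebra.adjoin_le_iff]
    rintro _ ⟨s, rfl⟩
    exact h s
  exact hle hx

/-- The automorphism `γ̂` of `C⋆_r(G, θ)` induced by `γ ∈ Aut(G)` preserving `θ`; it is
implemented by the unitary `ξ_g ↦ ξ_{γ(g)}`. -/
def inducedAut (θ : G → G → Circle) (γ : G ≃* G) (hγ : ∀ g h, θ (γ g) (γ h) = θ g h) :
    reducedAlgebra θ ≃⋆ₐ[ℂ] reducedAlgebra θ where
  toFun x := ⟨(autUnitary γ).conjStarAlgEquiv x,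
    reducedAlgebra_mapsTo θ ((autUnitary γ).conjStarAlgEquiv : _ →⋆ₐ[ℂ] _)
      (StarAlgEquiv.isometry (autUnitary γ).conjStarAlgEquiv).continuous
      (fun s => by simpa [conj_lam θ γ hγ] using lam_mem θ _) x.2⟩
  invFun x := ⟨(autUnitary γ).conjStarAlgEquiv.symm x,
    reducedAlgebra_mapsTo θ ((autUnitary γ).conjStarAlgEquiv.symm : _ →⋆ₐ[ℂ] _)
      (StarAlgEquiv.isometry (autUnitary γ).conjStarAlgEquiv.symm).continuous
      (fun s => by
        have := conj_symm_lam θ γ hγ s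
        simpa [-LinearIsometryEquiv.symm_conjStarAlgEquiv, this] using lam_mem θ _) x.2⟩
  left_inv x := Subtype.ext ((autUnitary γ).conjStarAlgEquiv.symm_apply_apply x)
  right_inv x := Subtype.ext ((autUnitary γ).conjStarAlgEquiv.apply_symm_apply x)
  map_mul' x y := by ext1; simp
  map_add' x y := by ext1; simp
  map_star' x := by ext1; simp [map_star]
  map_smul' c x := by ext1; simp

/-- `γ̂(λ^θ_g) = λ^θ_{γ(g)}`. -/
theorem inducedAut_lamElt (θ : G → G → Circle) (γ : G ≃* G)
    (hγ : ∀ g h, θ (γ g) (γ h) = θ g h) (g : G) :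
    inducedAut θ γ hγ (lamElt θ g) = lamElt θ (γ g) :=
  Subtype.ext (conj_lam θ γ hγ g)

/-- Brown's entropy `ht(γ̂)`, formed with the inclusion `C⋆_r(G, θ) ⊆ B(ℓ²(G))`. -/
def inducedEntropy (θ : G → G → Circle) (γ : G ≃* G) (hγ : ∀ g h, θ (γ g) (γ h) = θ g h) :
    EReal :=
  brownEntropy (reducedAlgebra θ).subtype (inducedAut θ γ hγ)

end Twisted

end DualEntropy

end

/-! A normalized `T` with `n`-element support yields an approximation of `C⋆_r(G, θ)` through the `n
× n` matrices, a C⋆-algebra of rank at most `n`, with error on `λ^θ_s` controlled by `‖s.T - T‖₁`.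

Fix a character `χ₀` of `A`. The functions `a_h(g) = χ₀(α_{h⁻¹}(T(g)))` are probability densities on
`G`, supported in `supp T`, and `∑_g |a_h(g) - a_{sh}(sg)| ≤ ‖s.T - T‖₁` (`exists_densities`). Let
`φ` compress operators to `ℓ²(supp T)`, and let `ψ(m) = ∑ mᵢⱼ wᵢ⋆ wⱼ`, where the `w`'s are indexed
by `g ∈ supp T` and `w_g ξ_h = √a_h(g) θ(h, h⁻¹g) ξ_{h⁻¹g}`. Since `∑ w_g⋆ w_g = 1`, both maps are
contractive and completely positive. The twist in `w_g` is chosen so that the cocycle identity gives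
`ψφ(λ^θ_s) ξ_h = K_s(h) λ^θ_s ξ_h`, with `K_s(h) = ∑_g √a_h(g) √a_{sh}(sg)`
(`rowCompression_lam_basisVec`). This affinity of two densities differs from `1` by at most their
`ℓ¹`-distance, so `‖ψφ(λ^θ_s) - λ^θ_s‖ ≤ ‖s.T - T‖₁`.

A finite subset of the algebra is approximated by combinations of finitely many `λ^θ_s`. As `γ̂` is
isometric and permutes these unitaries through `γ`, the same coefficients and tolerance serve along
the whole orbit (`exists_rcp_orbitUnion_le_amenableRank`), and the ranks compare for every `n`. -/

noncomputable section

namespace DualEntropy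

/-! ### Weighted permutation operators on `ℓ²(G)`. -/

section Monomial

variable {G : Type*}

theorem L2.norm_sq_eq (f : L2 G) : ‖f‖ ^ 2 = ∑' h, ‖f h‖ ^ 2 := by
  simpa using lp.norm_rpow_eq_tsum (p := 2) (by norm_num) f

theorem L2.summable_sq (f : L2 G) : Summable fun h => ‖f h‖ ^ 2 := by
  simpa using (memℓp_gen_iff (p := 2) (by norm_num)).1 (lp.memℓp f)

theorem memℓp_weighted (σ : Equiv.Perm G) (c : G → ℂ) {C : ℝ} (hc : ∀ h, ‖c h‖ ≤ C) (f : L2 G) :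
    Memℓp (fun h => c (σ.symm h) * f (σ.symm h)) 2 := by
  refine (memℓp_gen_iff (p := 2) (by norm_num)).2 ?_
  have h := (((σ.symm.summable_iff).2 (L2.summable_sq f)).mul_left (C ^ 2))
  refine Summable.of_nonneg_of_le (fun _ => by positivity) (fun h => ?_) h
  simp only [ENNReal.toReal_ofNat, Real.rpow_ofNat, norm_mul, Function.comp_apply, mul_pow]
  gcongr
  exact hc _

/-- The bounded operator `ξ_g ↦ c(g) ξ_{σ(g)}` of `ℓ²(G)`. -/
def monomialOp (σ : Equiv.Perm G) (c : G → ℂ) {C : ℝ} (hC : 0 ≤ C) (hc : ∀ h, ‖c h‖ ≤ C) :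
    L2 G →L[ℂ] L2 G :=
  LinearMap.mkContinuous
    { toFun := fun f => ⟨fun h => c (σ.symm h) * f (σ.symm h), memℓp_weighted σ c hc f⟩
      map_add' := fun f g => by
        ext h
        exact mul_add _ _ _
      map_smul' := fun a f => by
        ext h
        simp [mul_left_comm] } C fun f => by
    refine le_of_sq_le_sq ?_ (by positivity)
    rw [mul_pow, L2.norm_sq_eq, L2.norm_sq_eq, ← tsum_mul_left,
      ← σ.symm.tsum_eq fun h => C ^ 2 * ‖f h‖ ^ 2]
    refine Summable.tsum_le_tsum (fun h => ?_) (L2.summable_sq _)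
      ((σ.symm.summable_iff).2 ((L2.summable_sq f).mul_left (C ^ 2)))
    change ‖c (σ.symm h) * f (σ.symm h)‖ ^ 2 ≤ _
    rw [norm_mul, mul_pow]
    gcongr
    exact hc _

theorem norm_monomialOp_le (σ : Equiv.Perm G) (c : G → ℂ) {C : ℝ} (hC : 0 ≤ C)
    (hc : ∀ h, ‖c h‖ ≤ C) : ‖monomialOp σ c hC hc‖ ≤ C :=
  LinearMap.mkContinuous_norm_le _ hC _

theorem monomialOp_apply (σ : Equiv.Perm G) (c : G → ℂ) {C : ℝ} (hC : 0 ≤ C)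
    (hc : ∀ h, ‖c h‖ ≤ C) (f : L2 G) (h : G) :
    monomialOp σ c hC hc f h = c (σ.symm h) * f (σ.symm h) := rfl

theorem basisVec_apply [DecidableEq G] (g h : G) :
    basisVec g h = if h = g then 1 else 0 := by
  by_cases hg : h = g
  · subst hg
    simp [basisVec]
  · simp [basisVec, hg]

theorem monomialOp_basisVec (σ : Equiv.Perm G) (c : G → ℂ) {C : ℝ} (hC : 0 ≤ C)
    (hc : ∀ h, ‖c h‖ ≤ C) (g : G) :
    monomialOp σ c hC hc (basisVec g) = c g • basisVec (σ g) := by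
  classical
  ext h
  rw [monomialOp_apply, lp.coeFn_smul, Pi.smul_apply, basisVec_apply, basisVec_apply]
  by_cases hg : h = σ g
  · simp [hg]
  · have : σ.symm h ≠ g := fun e => hg (by simp [← e])
    simp [hg, this]

theorem inner_basisVec [DecidableEq G] (g h : G) :
    inner ℂ (basisVec g) (basisVec h) = if g = h then (1 : ℂ) else 0 := by
  have hg : basisVec g = lp.single (E := fun _ : G => ℂ) 2 g 1 := by
    ext k
    rw [basisVec_apply]
    by_cases hk : k = g
    · subst hk; simp
    · simp [hk]
  rw [hg, lp.inner_single_left, basisVec_apply]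
  simp

theorem orthonormal_basisVec : Orthonormal ℂ (basisVec (G := G)) := by
  classical
  rw [orthonormal_iff_ite]
  exact inner_basisVec

theorem ext_basisVec {S T : L2 G →L[ℂ] L2 G} (h : ∀ g, S (basisVec g) = T (basisVec g)) :
    S = T := by
  classical
  ext1 f
  have hf := lp.hasSum_single (p := 2) (by norm_num) f
  refine (hf.mapL S).unique ?_
  convert hf.mapL T using 2 with g
  have : lp.single (E := fun _ : G => ℂ) 2 g (f g) = f g • basisVec g := by
    ext k
    rw [lp.coeFn_smul, Pi.smul_apply, basisVec_apply]
    by_cases hk : k = g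
    · subst hk; simp
    · simp [hk]
  rw [this, map_smul, map_smul, h]

/-- Estimates the error `ψφ(λ^θ_s) - λ^θ_s`, which is a weighted translation: its norm is governed
by its weights alone. -/
theorem opNorm_le_of_basisVec {R : L2 G →L[ℂ] L2 G} (σ : Equiv.Perm G) (c : G → ℂ) {C : ℝ}
    (hC : 0 ≤ C) (hc : ∀ h, ‖c h‖ ≤ C) (hR : ∀ g, R (basisVec g) = c g • basisVec (σ g)) :
    ‖R‖ ≤ C := by
  have : R = monomialOp σ c hC hc := ext_basisVec fun g => by rw [hR, monomialOp_basisVec]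
  exact this ▸ norm_monomialOp_le _ _ _ _

theorem star_monomialOp (σ : Equiv.Perm G) (c : G → ℂ) {C : ℝ} (hC : 0 ≤ C)
    (hc : ∀ h, ‖c h‖ ≤ C) :
    star (monomialOp σ c hC hc) = monomialOp σ.symm (fun h => star (c (σ.symm h))) hC
      (fun h => by simpa using hc _) := by
  rw [ContinuousLinearMap.star_eq_adjoint, eq_comm, ContinuousLinearMap.eq_adjoint_iff]
  intro x y
  rw [lp.inner_eq_tsum, lp.inner_eq_tsum, ← σ.symm.tsum_eq]
  refine tsum_congr fun h => ?_
  simp only [monomialOp_apply, Equiv.symm_symm, Equiv.apply_symm_apply, RCLike.inner_apply,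
    map_mul, RCLike.star_def, Complex.conj_conj]
  ring

end Monomial

section CompressionMaps

open scoped ComplexOrder

/-! ### The rank of a full matrix algebra. -/

section RankOfMatrices

/-- The diagonal matrices. -/
def diagonalSubalgebra (n : ℕ) : StarSubalgebra ℂ (CStarMatrix (Fin n) (Fin n) ℂ) where
  carrier := {M | ∀ i j, i ≠ j → M i j = 0}
  mul_mem' := fun {a b} ha hb i j hij => by
    rw [CStarMatrix.mul_apply]
    refine Finset.sum_eq_zero fun k _ => ?_
    by_cases hk : i = k
    · rw [hb k j (hk ▸ hij), mul_zero]
    · rw [ha i k hk, zero_mul]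
  add_mem' := fun {a b} ha hb i j hij => by
    rw [CStarMatrix.add_apply, ha i j hij, hb i j hij, add_zero]
  algebraMap_mem' := fun r i j hij => by
    rw [CStarMatrix.algebraMap_apply, if_neg hij]
  star_mem' := fun {a} ha i j hij => by
    rw [CStarMatrix.star_apply, ha j i hij.symm, star_zero]

theorem isMaximalAbelian_diagonalSubalgebra (n : ℕ) :
    IsMaximalAbelian (diagonalSubalgebra n) := by
  refine ⟨fun x hx y hy => ?_, fun S hS hle x hx i j hij => ?_⟩
  · ext i j
    rw [CStarMatrix.mul_apply, CStarMatrix.mul_apply]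
    refine Finset.sum_congr rfl fun k _ => ?_
    by_cases hik : i = k
    · subst hik
      by_cases hij : i = j
      · subst hij
        exact mul_comm _ _
      · rw [hx i j hij, hy i j hij, mul_zero, mul_zero]
    · rw [hx i k hik, hy i k hik, zero_mul, zero_mul]
  -- Commuting with the `i`-th diagonal matrix unit kills the off-diagonal part of row `i`.
  · let E : CStarMatrix (Fin n) (Fin n) ℂ :=
      CStarMatrix.ofMatrix (Matrix.diagonal (Pi.single i 1))
    have hE : E ∈ diagonalSubalgebra n := fun a b hab => by
      simp [E, Matrix.diagonal_apply_ne _ hab]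
    have h := congrFun (congrFun (hS E (hle hE) x hx) i) j
    rw [CStarMatrix.mul_apply, CStarMatrix.mul_apply] at h
    simpa [E, Matrix.diagonal_apply, Pi.single_apply, hij, hij.symm] using h

theorem finrank_diagonalSubalgebra_le (n : ℕ) :
    Module.finrank ℂ (diagonalSubalgebra n) ≤ n := by
  let L : diagonalSubalgebra n →ₗ[ℂ] (Fin n → ℂ) :=
    { toFun := fun M i => M.1 i i
      map_add' := fun _ _ => rfl
      map_smul' := fun _ _ => rfl }
  have hL : Function.Injective L := fun M N h => by
    ext i j
    by_cases hij : i = j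
    · subst hij
      exact congrFun h i
    · rw [M.2 i j hij, N.2 i j hij]
  simpa using LinearMap.finrank_le_finrank_of_injective hL

theorem cstarRank_le_finrank {B : Type*} [CStarAlgebra B] {S : StarSubalgebra ℂ B}
    (hS : IsMaximalAbelian S) : cstarRank B ≤ Module.finrank ℂ S :=
  Nat.sInf_le ⟨S, hS, rfl⟩

theorem cstarRank_cstarMatrix_le (n : ℕ) :
    cstarRank (CStarMatrix (Fin n) (Fin n) ℂ) ≤ n :=
  (cstarRank_le_finrank (isMaximalAbelian_diagonalSubalgebra n)).trans
    (finrank_diagonalSubalgebra_le n)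

end RankOfMatrices

/-! ### The map `ψ` out of the matrices: complete positivity and contractivity. -/

section RowCompression

variable {C : Type*} [CStarAlgebra C] [PartialOrder C] [StarOrderedRing C] {n : ℕ}

theorem exists_eq_star_mul_self_of_nonneg {A : Type*} [NonUnitalCStarAlgebra A]
    [PartialOrder A] [StarOrderedRing A] {x : A} (hx : 0 ≤ x) : ∃ y, x = star y * y :=
  CStarAlgebra.nonneg_iff_eq_star_mul_self.1 hx

/-- The `(a, b)` entry as a linear map. -/
def _root_.CStarMatrix.entryₗ {k : ℕ} (a b : Fin k) : CStarMatrix (Fin k) (Fin k) C →ₗ[ℂ] C where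
  toFun M := M a b
  map_add' _ _ := rfl
  map_smul' _ _ := rfl

theorem map_star_mul_self_apply {A B : Type*} [CStarAlgebra A] [AddCommGroup B] [Module ℂ B]
    (L : A →ₗ[ℂ] B) {k : ℕ} (N : CStarMatrix (Fin k) (Fin k) A) (a b : Fin k) :
    (star N * N).map L a b = ∑ c, L (star (N c a) * N c b) := by
  rw [CStarMatrix.map_apply, CStarMatrix.mul_apply, map_sum]
  rfl

/-- A sum of Gram matrices of rows is positive. -/
theorem cstarMatrix_nonneg_of_eq_sum {k : ℕ} {ι : Type*} (s : Finset ι) (x : ι → Fin k → C)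
    (M : CStarMatrix (Fin k) (Fin k) C) (hM : ∀ a b, M a b = ∑ i ∈ s, star (x i a) * x i b) :
    0 ≤ M := by
  let P : ι → CStarMatrix (Fin k) (Fin k) C := fun i =>
    CStarMatrix.ofMatrix fun a b => star (x i a) * x i b
  have hMP : M = ∑ i ∈ s, P i := by
    ext a b
    exact (hM a b).trans (map_sum (CStarMatrix.entryₗ a b) P s).symm
  rw [hMP]
  refine Finset.sum_nonneg fun i _ => ?_
  -- A row is turned into a square matrix by placing it in row `0` and filling with zeros; this
  -- needs an index `0`.
  rcases k with _ | k
  · exact (CStarMatrix.ext fun a => a.elim0 : (0 : CStarMatrix (Fin 0) (Fin 0) C) = P i).le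
  let N : CStarMatrix (Fin (k + 1)) (Fin (k + 1)) C :=
    CStarMatrix.ofMatrix fun a b => if a = 0 then x i b else 0
  have hN : ∀ a b, N a b = if a = 0 then x i b else 0 := fun _ _ => rfl
  have : P i = star N * N := by
    ext a b
    rw [CStarMatrix.mul_apply, Finset.sum_eq_single 0]
    · rw [CStarMatrix.star_apply, hN, hN, if_pos rfl, if_pos rfl]
      rfl
    · intro c _ hc
      rw [hN c b, if_neg hc, mul_zero]
    · simp
  rw [this]
  exact star_mul_self_nonneg N

/-- The linear map `m ↦ ∑ᵢⱼ mᵢⱼ wᵢ⋆ wⱼ`. -/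
def rowCompressionₗ (w : Fin n → C) : CStarMatrix (Fin n) (Fin n) ℂ →ₗ[ℂ] C where
  toFun m := ∑ i, ∑ j, m i j • (star (w i) * w j)
  map_add' m m' := by simp [add_smul, Finset.sum_add_distrib]
  map_smul' c m := by simp [Finset.smul_sum, smul_smul]

omit [PartialOrder C] [StarOrderedRing C] in
theorem rowCompressionₗ_apply (w : Fin n → C) (m : CStarMatrix (Fin n) (Fin n) ℂ) :
    rowCompressionₗ w m = ∑ i, ∑ j, m i j • (star (w i) * w j) := rfl

omit [PartialOrder C] [StarOrderedRing C] in
theorem rowCompressionₗ_star_mul (w : Fin n → C) (x y : CStarMatrix (Fin n) (Fin n) ℂ) :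
    rowCompressionₗ w (star x * y) =
      ∑ l, star (∑ i, x l i • w i) * ∑ j, y l j • w j := by
  rw [rowCompressionₗ_apply]
  simp only [CStarMatrix.mul_apply, CStarMatrix.star_apply, star_sum, star_smul, Finset.sum_mul_sum, Finset.sum_smul,
    smul_mul_smul_comm]
  rw [Finset.sum_comm (f := fun l i => ∑ j, (star (x l i) * y l j) • (star (w i) * w j))]
  exact Finset.sum_congr rfl fun i _ => Finset.sum_comm

/-- The completely positive map `m ↦ ∑ᵢⱼ mᵢⱼ wᵢ⋆ wⱼ`. -/
def rowCompression (w : Fin n → C) : CStarMatrix (Fin n) (Fin n) ℂ →CP C where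
  __ := rowCompressionₗ w
  map_cstarMatrix_nonneg' k M hM := by
    obtain ⟨N, rfl⟩ := exists_eq_star_mul_self_of_nonneg hM
    -- The rows are indexed by a row of `N` together with a row of the matrices that are its
    -- entries.
    refine cstarMatrix_nonneg_of_eq_sum (Finset.univ : Finset (Fin k × Fin n))
      (fun p a => ∑ j, N p.1 a p.2 j • w j) _ fun a b => ?_
    refine (map_star_mul_self_apply (rowCompressionₗ w) N a b).trans ?_
    simp_rw [rowCompressionₗ_star_mul]
    rw [Fintype.sum_prod_type]

theorem rowCompression_apply (w : Fin n → C) (m : CStarMatrix (Fin n) (Fin n) ℂ) :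
    rowCompression w m = ∑ i, ∑ j, m i j • (star (w i) * w j) := rfl

/-- With `W` the column of the `wᵢ`, an isometry by `hw`, the map is `m ↦ W⋆mW`. Cauchy–Schwarz in
the form `(W⋆mW)⋆(W⋆mW) ≤ W⋆m⋆mW ≤ ‖m‖²` gives the bound without block operators. -/
theorem norm_rowCompression_le (w : Fin n → C) (hw : ∑ i, star (w i) * w i = 1)
    (m : CStarMatrix (Fin n) (Fin n) ℂ) : ‖rowCompression w m‖ ≤ ‖m‖ := by
  set y := rowCompression w m with hy
  let c : Fin n → C := fun l => ∑ j, m l j • w j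
  have hyc : y = ∑ l, star (w l) * c l := by
    simp [hy, rowCompression_apply, c, Finset.mul_sum]
  have hcc : rowCompression w (star m * m) = ∑ l, star (c l) * c l :=
    rowCompressionₗ_star_mul w m m
  have h1 : star y * y ≤ ∑ l, star (c l) * c l := by
    -- This is `|mW - Wy|² ≥ 0`; expanding it with `W⋆W = 1` and `W⋆mW = y` leaves `W⋆m⋆mW - y⋆y`.
    have h0 : 0 ≤ ∑ l, star (c l - w l * y) * (c l - w l * y) :=
      Finset.sum_nonneg fun l _ => star_mul_self_nonneg _
    have : ∑ l, star (c l - w l * y) * (c l - w l * y) =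
        ∑ l, star (c l) * c l - (∑ l, star (star (w l) * c l)) * y
          - star y * ∑ l, star (w l) * c l + star y * (∑ l, star (w l) * w l) * y := by
      simp only [Finset.mul_sum, Finset.sum_mul, ← Finset.sum_sub_distrib, ← Finset.sum_add_distrib]
      refine Finset.sum_congr rfl fun l _ => ?_
      simp only [star_sub, star_mul, star_star]
      noncomm_ring
    rw [this, hw, ← star_sum, ← hyc, mul_one] at h0
    rw [← sub_nonneg]
    simpa using h0
  have hone : rowCompression w 1 = 1 := by
    simp [rowCompression_apply, CStarMatrix.one_apply, hw]
  have h2 : ∑ l, star (c l) * c l ≤ algebraMap ℝ C (‖m‖ ^ 2) := by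
    rw [← hcc]
    have := OrderHomClass.mono (rowCompression w) (CStarAlgebra.star_mul_le_algebraMap_norm_sq (a := m))
    refine this.trans (le_of_eq ?_)
    rw [Algebra.algebraMap_eq_smul_one, Algebra.algebraMap_eq_smul_one, ← hone]
    have := map_smul (rowCompression w) ((‖m‖ ^ 2 : ℝ) : ℂ) 1
    rwa [Complex.coe_smul, Complex.coe_smul] at this
  have h3 : ‖star y * y‖ ≤ ‖m‖ ^ 2 := by
    refine (CStarAlgebra.norm_le_norm_of_nonneg_of_le (star_mul_self_nonneg y) (h1.trans h2)).trans ?_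
    rcases subsingleton_or_nontrivial C with _ | _
    · rw [Subsingleton.elim (algebraMap ℝ C (‖m‖ ^ 2)) 0, norm_zero]
      positivity
    · rw [norm_algebraMap']
      simp
  rw [CStarRing.norm_star_mul_self, ← sq] at h3
  exact le_of_sq_le_sq h3 (norm_nonneg _)

end RowCompression

/-! ### The map `φ` into the matrices: complete positivity and contractivity. -/

section VectorCompression

variable {A : Type*} [CStarAlgebra A] [PartialOrder A] [StarOrderedRing A]
  {H : Type*} [NormedAddCommGroup H] [InnerProductSpace ℂ H] [CompleteSpace H] {n : ℕ}

/-- A block matrix is positive if it is positive semidefinite as a scalar matrix. -/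
theorem cstarMatrix_nonneg_of_posSemidef {k : ℕ}
    (M : CStarMatrix (Fin k) (Fin k) (CStarMatrix (Fin n) (Fin n) ℂ))
    (hM : (Matrix.of fun p q : Fin k × Fin n => M p.1 q.1 p.2 q.2).PosSemidef) : 0 ≤ M := by
  -- A scalar positive semidefinite matrix is a sum of rank-one terms; each is a Gram matrix of rows
  -- over the block algebra, with the vector stored in row `0` of its blocks.
  obtain ⟨r, v, hv⟩ := Matrix.posSemidef_iff_eq_sum_vecMulVec.1 hM
  rcases n with _ | n
  · exact (CStarMatrix.ext fun a b => CStarMatrix.ext fun i => i.elim0 : 0 = M).le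
  let x : Fin r → Fin k → CStarMatrix (Fin (n + 1)) (Fin (n + 1)) ℂ := fun l b =>
    CStarMatrix.ofMatrix fun i j => if i = 0 then star (v l (b, j)) else 0
  have hx : ∀ l b i j, x l b i j = if i = 0 then star (v l (b, j)) else 0 := fun _ _ _ _ => rfl
  refine cstarMatrix_nonneg_of_eq_sum Finset.univ x M fun a b => ?_
  ext i j
  have h := congrFun (congrFun hv (a, i)) (b, j)
  rw [Matrix.of_apply, Matrix.sum_apply] at h
  rw [h]
  refine Eq.trans ?_ (map_sum (CStarMatrix.entryₗ i j)
    (fun l => star (x l a) * x l b) Finset.univ).symm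
  refine Finset.sum_congr rfl fun l _ => ?_
  change _ = (star (x l a) * x l b) i j
  rw [CStarMatrix.mul_apply, Finset.sum_eq_single 0]
  · simp [CStarMatrix.star_apply, hx, Matrix.vecMulVec_apply]
  · intro c _ hc
    rw [hx l b, if_neg hc, mul_zero]
  · simp

/-- The compression `x ↦ (⟨eᵢ, π(x) eⱼ⟩)ᵢⱼ`. -/
def vectorCompressionₗ (π : A →⋆ₐ[ℂ] (H →L[ℂ] H)) (e : Fin n → H) :
    A →ₗ[ℂ] CStarMatrix (Fin n) (Fin n) ℂ where
  toFun x := CStarMatrix.ofMatrix fun i j => inner ℂ (e i) (π x (e j))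
  map_add' x y := by
    ext i j
    change inner ℂ (e i) (π (x + y) (e j)) = inner ℂ (e i) (π x (e j)) + inner ℂ (e i) (π y (e j))
    simp
  map_smul' c x := by
    ext i j
    change inner ℂ (e i) (π (c • x) (e j)) = c * inner ℂ (e i) (π x (e j))
    simp

omit [PartialOrder A] [StarOrderedRing A] in
theorem vectorCompressionₗ_star_mul (π : A →⋆ₐ[ℂ] (H →L[ℂ] H)) (e : Fin n → H) (x y : A)
    (i j : Fin n) :
    vectorCompressionₗ π e (star x * y) i j = inner ℂ (π x (e i)) (π y (e j)) := by
  have h : π (star x * y) = ContinuousLinearMap.adjoint (π x) * π y := by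
    rw [map_mul, map_star, ContinuousLinearMap.star_eq_adjoint]
  change inner ℂ (e i) (π (star x * y) (e j)) = _
  rw [h, mul_apply_eq_comp]
  exact ContinuousLinearMap.adjoint_inner_right (π x) (e i) (π y (e j))

/-- The completely positive map `x ↦ (⟨eᵢ, π(x) eⱼ⟩)ᵢⱼ`. -/
def vectorCompression (π : A →⋆ₐ[ℂ] (H →L[ℂ] H)) (e : Fin n → H) :
    A →CP CStarMatrix (Fin n) (Fin n) ℂ where
  __ := vectorCompressionₗ π e
  map_cstarMatrix_nonneg' k M hM := by
    obtain ⟨N, rfl⟩ := exists_eq_star_mul_self_of_nonneg hM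
    refine cstarMatrix_nonneg_of_posSemidef _ ?_
    -- For `M = N⋆N`, the flattened block matrix is a sum over the rows of `N` of Gram matrices of
    -- vectors in `H`.
    have : (Matrix.of fun p q : Fin k × Fin n =>
        (star N * N).map (vectorCompressionₗ π e) p.1 q.1 p.2 q.2) =
        ∑ c, Matrix.gram ℂ fun p : Fin k × Fin n => π (N c p.1) (e p.2) := by
      ext p q
      rw [Matrix.sum_apply, Matrix.of_apply, map_star_mul_self_apply]
      refine (map_sum (CStarMatrix.entryₗ p.2 q.2)
        (fun c => vectorCompressionₗ π e (star (N c p.1) * N c q.1)) Finset.univ).trans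
        (Finset.sum_congr rfl fun c _ => ?_)
      exact vectorCompressionₗ_star_mul π e _ _ _ _
    exact this ▸ Matrix.posSemidef_sum _ fun c _ => Matrix.posSemidef_gram ℂ _

theorem vectorCompression_apply (π : A →⋆ₐ[ℂ] (H →L[ℂ] H)) (e : Fin n → H) (x : A) (i j : Fin n) :
    vectorCompression π e x i j = inner ℂ (e i) (π x (e j)) := rfl

/-- The compression is `V⋆π(x)V` with `V : v ↦ ∑ vⱼeⱼ` isometric. Bessel's inequality takes the
place of the contractivity of `V⋆`. -/
theorem norm_vectorCompression_le (π : A →⋆ₐ[ℂ] (H →L[ℂ] H)) {e : Fin n → H}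
    (he : Orthonormal ℂ e) (x : A) : ‖vectorCompression π e x‖ ≤ ‖x‖ := by
  let Φ : CStarMatrix (Fin n) (Fin n) ℂ ≃⋆ₐ[ℂ]
      (EuclideanSpace ℂ (Fin n) →L[ℂ] EuclideanSpace ℂ (Fin n)) :=
    CStarMatrix.ofMatrixStarAlgEquiv.symm.trans Matrix.toEuclideanCLM
  rw [← (StarAlgEquiv.isometry Φ).norm_map_of_map_zero (map_zero Φ)]
  refine ContinuousLinearMap.opNorm_le_bound _ (norm_nonneg _) fun v => ?_
  set z : H := ∑ j, v j • e j with hz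
  have hcoord : ∀ i, Φ (vectorCompression π e x) v i = inner ℂ (e i) (π x z) := fun i => by
    change ((vectorCompression π e x : Matrix (Fin n) (Fin n) ℂ).mulVec v.ofLp) i = _
    simp only [Matrix.mulVec, dotProduct, hz, map_sum, map_smul, inner_sum, inner_smul_right]
    exact Finset.sum_congr rfl fun j _ => by rw [vectorCompression_apply, mul_comm]
  have hzn : ‖z‖ = ‖v‖ := by
    refine (sq_eq_sq₀ (norm_nonneg _) (norm_nonneg _)).1 ?_
    rw [EuclideanSpace.norm_sq_eq, ← inner_self_eq_norm_sq (𝕜 := ℂ), hz, he.inner_sum]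
    simp [RCLike.conj_mul, ← Complex.ofReal_pow, -map_pow]
  rw [← hzn]
  refine le_trans ?_ ((ContinuousLinearMap.le_opNorm (π x) z).trans
    (mul_le_mul_of_nonneg_right (NonUnitalStarAlgHom.norm_apply_le π x) (norm_nonneg _)))
  refine le_of_sq_le_sq ?_ (norm_nonneg _)
  rw [EuclideanSpace.norm_sq_eq]
  simp_rw [hcoord]
  exact he.sum_inner_products_le _

end VectorCompression

end CompressionMaps

/-! ### Affinity of two probability densities. -/

section Affinity

/-- From above, AM–GM. From below, `√p√q ≥ min(p, q) = (p + q)/2 - |p - q|/2`; the cruder bound with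
the full `|p - q|` suffices here. -/
theorem abs_sub_one_tsum_sqrt_mul_sqrt_le {ι : Type*} {p q : ι → ℝ} {d : ℝ} (hp0 : ∀ i, 0 ≤ p i)
    (hq0 : ∀ i, 0 ≤ q i) (hp : HasSum p 1) (hq : HasSum q 1)
    (hd : HasSum (fun i => |p i - q i|) d) : |∑' i, √(p i) * √(q i) - 1| ≤ d := by
  have hle : ∀ i, √(p i) * √(q i) ≤ (p i + q i) / 2 := fun i => by
    nlinarith [sq_nonneg (√(p i) - √(q i)), Real.sq_sqrt (hp0 i), Real.sq_sqrt (hq0 i)]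
  have hge : ∀ i, (p i + q i) / 2 - |p i - q i| ≤ √(p i) * √(q i) := fun i => by
    rcases le_total (p i) (q i) with h | h
    · have := Real.sqrt_le_sqrt h
      rw [abs_of_nonpos (by linarith)]
      nlinarith [Real.sqrt_nonneg (p i), Real.sq_sqrt (hp0 i)]
    · have := Real.sqrt_le_sqrt h
      rw [abs_of_nonneg (by linarith)]
      nlinarith [Real.sqrt_nonneg (q i), Real.sq_sqrt (hq0 i)]
  have hs : Summable fun i => √(p i) * √(q i) :=
    Summable.of_nonneg_of_le (fun i => by positivity) hle ((hp.add hq).div_const 2).summable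
  have h1 := hasSum_le hle hs.hasSum ((hp.add hq).div_const 2)
  have h2 := hasSum_le hge (((hp.add hq).div_const 2).sub hd) hs.hasSum
  have h3 : 0 ≤ d := hd.nonneg fun i => abs_nonneg _
  rw [abs_le]
  constructor <;> linarith

end Affinity

/-! ### Characters and the `ℓ¹`-norm. -/

section Characters

open scoped ComplexOrder

variable {G : Type*} [Group G] {A : Type*} [CommCStarAlgebra A] [PartialOrder A]
  [StarOrderedRing A]

theorem character_abs (χ : A →⋆ₐ[ℂ] ℂ) (a : A) : χ (CFC.abs a) = (‖χ a‖ : ℂ) := by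
  have h0 : 0 ≤ χ (CFC.abs a) := map_nonneg χ (CFC.abs_nonneg a)
  have h1 : χ (CFC.abs a) * χ (CFC.abs a) = (‖χ a‖ : ℂ) * ‖χ a‖ := by
    rw [← map_mul, CFC.abs_mul_abs, map_mul, map_star, RCLike.star_def, RCLike.conj_mul, sq]
    rfl
  obtain ⟨r, hr⟩ : ∃ r : ℝ, χ (CFC.abs a) = r := ⟨_, (Complex.eq_re_of_ofReal_le h0)⟩
  rw [hr] at h0 h1 ⊢
  norm_cast at h0 h1 ⊢
  exact (mul_self_inj h0 (norm_nonneg _)).1 h1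

omit [Group G] in
-- A character turns `|T(g)|` into the scalar `|χ(T(g))|`, is continuous and is contractive, so it
-- carries the `A`-valued `ℓ¹`-norm to a bound on a scalar one.
theorem exists_hasSum_norm_character (χ : A →⋆ₐ[ℂ] ℂ) {T : G → A} (hT : MemL1 T) :
    ∃ d, HasSum (fun g => ‖χ (T g)‖) d ∧ d ≤ l1Norm T := by
  have hχ : Continuous χ := (χ : A →ₐ[ℂ] ℂ).toContinuousLinearMap.continuous
  have h := (hT.hasSum).map χ hχ
  have h' : HasSum (fun g => ‖χ (T g)‖) (χ (∑' g, CFC.abs (T g))).re := by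
    convert Complex.hasSum_re h using 2 with g
    simp [character_abs]
  exact ⟨_, h', (Complex.re_le_norm _).trans (NonUnitalStarAlgHom.norm_apply_le χ _)⟩

end Characters

/-! ### Density of the span of the `λ^θ_s`. -/

section Spanning

variable {G : Type*} [Group G] {θ : G → G → Circle}

theorem lam_mul_lam (hθ : IsCocycle θ) (s t : G) :
    lam θ s * lam θ t = (θ s t : ℂ) • lam θ (s * t) := by
  refine ext_basisVec fun g => ?_
  have := congrArg (fun z : Circle => (z : ℂ)) (hθ.cocycle s t g)
  simp only [Circle.coe_mul] at this
  rw [mul_apply_eq_comp, lam_basisVec, map_smul, lam_basisVec, smul_apply,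
    lam_basisVec, smul_smul, smul_smul, mul_assoc, this]

theorem lam_one (hθ : IsCocycle θ) : lam θ 1 = 1 := by
  refine ext_basisVec fun g => ?_
  rw [lam_basisVec, hθ.one_left, one_mul, Circle.coe_one, one_smul]
  rfl

theorem star_lam (hθ : IsCocycle θ) (s : G) :
    star (lam θ s) = ((θ s s⁻¹)⁻¹ : Circle) • lam θ s⁻¹ := by
  have h1 : star (lam θ s) * lam θ s = 1 :=
    (ContinuousLinearMap.norm_map_iff_adjoint_comp_self _).1 (twistedTranslation θ s).norm_map
  have h2 : lam θ s * lam θ s⁻¹ = θ s s⁻¹ • 1 := by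
    rw [lam_mul_lam hθ, mul_inv_cancel, lam_one hθ]
    rfl
  rw [eq_inv_smul_iff, ← one_mul (lam θ s⁻¹), ← h1, mul_assoc, h2, mul_smul_comm, mul_one]

/-- Products and adjoints of the `λ^θ_s` are scalar multiples of some `λ^θ_t`, so the linear span is
already a unital `*`-algebra. -/
theorem adjoin_lam_le_span (hθ : IsCocycle θ) {x : L2 G →L[ℂ] L2 G}
    (hx : x ∈ StarAlgebra.adjoin ℂ (Set.range (lam θ))) :
    x ∈ Submodule.span ℂ (Set.range (lam θ)) := by
  induction hx using StarAlgebra.adjoin_induction with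
  | mem x hx => exact Submodule.subset_span hx
  | algebraMap r =>
    rw [Algebra.algebraMap_eq_smul_one, ← lam_one hθ]
    exact Submodule.smul_mem _ _ (Submodule.subset_span ⟨1, rfl⟩)
  | add x y _ _ hx hy => exact add_mem hx hy
  | mul x y _ _ hx hy =>
    have := Submodule.mul_mem_mul hx hy
    rw [Submodule.span_mul_span] at this
    refine Submodule.span_le.2 ?_ this
    rintro _ ⟨_, ⟨s, rfl⟩, _, ⟨t, rfl⟩, rfl⟩
    change lam θ s * lam θ t ∈ _
    rw [lam_mul_lam hθ]
    exact Submodule.smul_mem _ _ (Submodule.subset_span ⟨_, rfl⟩)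
  | star x h hx =>
    clear h
    induction hx using Submodule.span_induction with
    | mem x hx =>
      obtain ⟨s, rfl⟩ := hx
      rw [star_lam hθ, Circle.smul_def]
      exact Submodule.smul_mem _ _ (Submodule.subset_span ⟨_, rfl⟩)
    | zero => simp
    | add x y _ _ hx hy => rw [star_add]; exact add_mem hx hy
    | smul c x _ hx => rw [star_smul]; exact Submodule.smul_mem _ _ hx

theorem exists_norm_sub_sum_lamElt_lt (hθ : IsCocycle θ) (x : reducedAlgebra θ) {ε : ℝ}
    (hε : 0 < ε) : ∃ c : G →₀ ℂ, ‖x - ∑ s ∈ c.support, c s • lamElt θ s‖ < ε := by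
  obtain ⟨y, hy, hxy⟩ := Metric.mem_closure_iff.1 x.2 ε hε
  obtain ⟨c, rfl⟩ := Finsupp.mem_span_range_iff_exists_finsupp.1 (adjoin_lam_le_span hθ hy)
  refine ⟨c, ?_⟩
  rw [dist_eq_norm] at hxy
  change ‖((x - ∑ s ∈ c.support, c s • lamElt θ s : reducedAlgebra θ) : L2 G →L[ℂ] L2 G)‖ < ε
  simpa [Finsupp.sum, lamElt] using hxy

theorem norm_iterate_inducedAut_sub_le (γ : G ≃* G) (hγ : ∀ g h, θ (γ g) (γ h) = θ g h)
    (F : Finset G) (c : G → ℂ) (x : reducedAlgebra θ) (k : ℕ) :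
    ‖(inducedAut θ γ hγ)^[k] x - ∑ s ∈ F, c s • lamElt θ (γ^[k] s)‖ =
      ‖x - ∑ s ∈ F, c s • lamElt θ s‖ := by
  induction k with
  | zero => rfl
  | succ k ih =>
    rw [← ih, ← (StarAlgEquiv.isometry (inducedAut θ γ hγ)).norm_map_of_map_zero (map_zero _)
      ((inducedAut θ γ hγ)^[k] x - _)]
    simp only [map_sub, map_sum, map_smul, inducedAut_lamElt, Function.iterate_succ_apply']

end Spanning

/-! ### The composite `ψφ` on the generators. -/

section Multiplier

variable {G : Type*} [Group G] {θ : G → G → Circle} {n : ℕ} {f : Fin n → G} {a : G → G → ℝ}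

/-- The coefficient `√a_h(g) θ(h, h⁻¹g)`. -/
def sqrtCoeff (θ : G → G → Circle) (a : G → G → ℝ) (g h : G) : ℂ := √(a h g) * θ h (h⁻¹ * g)

theorem norm_sqrtCoeff (g h : G) : ‖sqrtCoeff θ a g h‖ = √(a h g) := by
  rw [sqrtCoeff, norm_mul, Circle.norm_coe, mul_one, Complex.norm_real, Real.norm_eq_abs,
    abs_of_nonneg (Real.sqrt_nonneg _)]

theorem norm_sqrtCoeff_le (ha : ∀ h g, a h g ≤ 1) (g h : G) : ‖sqrtCoeff θ a g h‖ ≤ 1 := by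
  rw [norm_sqrtCoeff]
  exact Real.sqrt_le_one.2 (ha h g)

/-- The permutation `h ↦ h⁻¹g` of `G`. -/
def invMulPerm (g : G) : Equiv.Perm G := (Equiv.inv G).trans (Equiv.mulRight g)

theorem invMulPerm_apply (g h : G) : invMulPerm g h = h⁻¹ * g := rfl

theorem invMulPerm_symm_apply (g h : G) : (invMulPerm g).symm h = g * h⁻¹ := by
  rw [Equiv.symm_apply_eq, invMulPerm_apply]
  group

/-- The operator `ξ_h ↦ √a_h(g) θ(h, h⁻¹g) ξ_{h⁻¹g}`. -/
def sqrtOp (θ : G → G → Circle) (ha : ∀ h g, a h g ≤ 1) (g : G) : L2 G →L[ℂ] L2 G :=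
  monomialOp (invMulPerm g) (sqrtCoeff θ a g) zero_le_one (norm_sqrtCoeff_le ha g)

theorem star_sqrtOp_mul_sqrtOp_basisVec (ha : ∀ h g, a h g ≤ 1) (g g' h : G) :
    (star (sqrtOp θ ha g') * sqrtOp θ ha g) (basisVec h) =
      (sqrtCoeff θ a g h * star (sqrtCoeff θ a g' (g' * g⁻¹ * h))) •
        basisVec (g' * g⁻¹ * h) := by
  have : g' * (h⁻¹ * g)⁻¹ = g' * g⁻¹ * h := by group
  rw [mul_apply_eq_comp, sqrtOp, sqrtOp, star_monomialOp, monomialOp_basisVec, map_smul,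
    monomialOp_basisVec, smul_smul, invMulPerm_apply, invMulPerm_symm_apply, this]

theorem sum_star_sqrtOp_mul_sqrtOp (ha0 : ∀ h g, 0 ≤ a h g) (ha : ∀ h g, a h g ≤ 1)
    (hsum : ∀ h, ∑ j, a h (f j) = 1) :
    ∑ j, star (sqrtOp θ ha (f j)) * sqrtOp θ ha (f j) = 1 := by
  refine ext_basisVec fun h => ?_
  have : ∀ j, (star (sqrtOp θ ha (f j)) * sqrtOp θ ha (f j)) (basisVec h) =
      (a h (f j) : ℂ) • basisVec h := fun j => by
    rw [star_sqrtOp_mul_sqrtOp_basisVec, mul_inv_cancel, one_mul, RCLike.star_def, RCLike.mul_conj,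
      norm_sqrtCoeff]
    congr 1
    exact (Complex.ofReal_pow _ _).symm.trans (congrArg _ (Real.sq_sqrt (ha0 h (f j))))
  rw [sum_apply, Finset.sum_congr rfl fun j _ => this j, ← Finset.sum_smul,
    ← Complex.ofReal_sum, hsum, Complex.ofReal_one, one_smul]
  rfl

/-- The cocycle identity at `(s, h, h⁻¹g)`: since `(sh)⁻¹(sg) = h⁻¹g`, the phases involving `g`
cancel and only `θ(s, h)` remains. Independence of the phase from `g` is what lets the sum over `g`
become an affinity. -/
theorem sqrtCoeff_mul_star (hθ : IsCocycle θ) (s g h : G) :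
    (θ s g : ℂ) * (sqrtCoeff θ a g h * star (sqrtCoeff θ a (s * g) (s * h))) =
      (√(a h g) * √(a (s * h) (s * g)) : ℝ) * θ s h := by
  have h1 := congrArg (fun z : Circle => (z : ℂ)) (hθ.cocycle s h (h⁻¹ * g))
  have h2 : (θ (s * h) (h⁻¹ * g) : ℂ) * (starRingEnd ℂ) (θ (s * h) (h⁻¹ * g)) = 1 := by
    rw [RCLike.mul_conj, Circle.norm_coe]
    simp
  have h3 : (s * h)⁻¹ * (s * g) = h⁻¹ * g := by group
  simp only [Circle.coe_mul, mul_inv_cancel_left] at h1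
  simp only [sqrtCoeff, h3, RCLike.star_def, map_mul, Complex.conj_ofReal, Complex.ofReal_mul]
  linear_combination (-(√(a h g) * √(a (s * h) (s * g)) : ℂ) *
    (starRingEnd ℂ) (θ (s * h) (h⁻¹ * g))) * h1 + (√(a h g) * √(a (s * h) (s * g)) * θ s h : ℂ) * h2

theorem rowCompression_lam_basisVec (hθ : IsCocycle θ) (hf : Function.Injective f)
    (ha : ∀ h g, a h g ≤ 1) (ha' : ∀ h, ∀ g ∉ Set.range f, a h g = 0)
    (m : CStarMatrix (Fin n) (Fin n) ℂ) (s : G)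
    (hm : ∀ i j, m i j = inner ℂ (basisVec (f i)) (lam θ s (basisVec (f j)))) (h : G) :
    (rowCompression (fun j => sqrtOp θ ha (f j)) m) (basisVec h) =
      ((∑' g, √(a h g) * √(a (s * h) (s * g)) : ℝ) * θ s h : ℂ) • basisVec (s * h) := by
  classical
  have hcol : ∀ j, ∑ i, m i j • (star (sqrtOp θ ha (f i)) * sqrtOp θ ha (f j)) (basisVec h) =
      ((√(a h (f j)) * √(a (s * h) (s * f j)) : ℝ) * θ s h : ℂ) • basisVec (s * h) := fun j => by
    have hterm : ∀ i, m i j • (star (sqrtOp θ ha (f i)) * sqrtOp θ ha (f j)) (basisVec h) =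
        if f i = s * f j then
          ((√(a h (f j)) * √(a (s * h) (s * f j)) : ℝ) * θ s h : ℂ) • basisVec (s * h)
        else 0 := fun i => by
      rw [hm, lam_basisVec, inner_smul_right, inner_basisVec, star_sqrtOp_mul_sqrtOp_basisVec]
      split_ifs with hij
      · rw [hij, mul_inv_cancel_right, mul_one, smul_smul, sqrtCoeff_mul_star hθ]
      · rw [mul_zero, zero_smul]
    rw [Finset.sum_congr rfl fun i _ => hterm i]
    -- Only the row with `f i = s * f j` contributes to column `j`. If there is no such row, the
    -- expected value vanishes too, because `a (s * h)` is zero off the range of `f`.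
    by_cases hs : s * f j ∈ Set.range f
    · obtain ⟨i, hi⟩ := hs
      rw [Finset.sum_eq_single i, if_pos hi]
      · intro b _ hb
        exact if_neg fun e => hb (hf (e.trans hi.symm))
      · simp
    · rw [ha' _ _ hs]
      refine (Finset.sum_eq_zero fun i _ => if_neg fun e => hs ⟨i, e⟩).trans ?_
      simp
  have htsum : ∑' g, √(a h g) * √(a (s * h) (s * g)) =
      ∑ j, √(a h (f j)) * √(a (s * h) (s * f j)) := by
    refine (hf.tsum_eq (f := fun g => √(a h g) * √(a (s * h) (s * g))) fun g hg => ?_).symm.trans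
      (tsum_fintype _)
    by_contra hg'
    exact hg (by simp [ha' h g hg'])
  rw [rowCompression_apply, Finset.sum_comm, sum_apply, htsum]
  simp only [sum_apply, smul_apply, hcol]
  rw [← Finset.sum_smul, ← Finset.sum_mul, Complex.ofReal_sum]

theorem norm_rowCompression_sub_lam_le (hθ : IsCocycle θ) (hf : Function.Injective f)
    (ha : ∀ h g, a h g ≤ 1) (ha' : ∀ h, ∀ g ∉ Set.range f, a h g = 0)
    (m : CStarMatrix (Fin n) (Fin n) ℂ) (s : G)
    (hm : ∀ i j, m i j = inner ℂ (basisVec (f i)) (lam θ s (basisVec (f j)))) {ε : ℝ} (hε : 0 ≤ ε)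
    (hK : ∀ h, |∑' g, √(a h g) * √(a (s * h) (s * g)) - 1| ≤ ε) :
    ‖rowCompression (fun j => sqrtOp θ ha (f j)) m - lam θ s‖ ≤ ε := by
  refine opNorm_le_of_basisVec (Equiv.mulLeft s)
    (fun h => ((∑' g, √(a h g) * √(a (s * h) (s * g)) - 1 : ℝ) * θ s h : ℂ)) hε (fun h => ?_)
    fun h => ?_
  · rw [norm_mul, Circle.norm_coe, mul_one, Complex.norm_real]
    exact hK h
  · rw [sub_apply, rowCompression_lam_basisVec hθ hf ha ha' m s hm, lam_basisVec, ← sub_smul,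
      Equiv.coe_mulLeft, Complex.ofReal_sub, Complex.ofReal_one, sub_mul, one_mul]

end Multiplier

/-! ### From a normalized `T` to a bound on the completely positive rank. -/

section Rank

variable {G : Type*} [Group G] {A : Type*} [CommCStarAlgebra A] [PartialOrder A]
  [StarOrderedRing A]

open scoped ComplexOrder in
/-- The probability densities `a_h = χ ∘ α_{h⁻¹} ∘ T` on `G`. -/
theorem exists_densities [Nontrivial A] (α : G →* (A ≃⋆ₐ[ℂ] A)) {T : G → A}
    (hT : IsNormalized T) (hfin : (Function.support T).Finite) :
    ∃ a : G → G → ℝ, (∀ h g, 0 ≤ a h g) ∧ (∀ h, HasSum (a h) 1) ∧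
      (∀ h, ∀ g ∉ Function.support T, a h g = 0) ∧
      ∀ s h, |∑' g, √(a h g) * √(a (s * h) (s * g)) - 1| ≤ l1Norm (translate α s T - T) := by
  obtain ⟨χ₀⟩ : Nonempty (WeakDual.characterSpace ℂ A) := inferInstance
  let χ : G → A →⋆ₐ[ℂ] ℂ := fun h =>
    (StarAlgHomClass.toStarAlgHom χ₀).comp (α h⁻¹ : A →⋆ₐ[ℂ] A)
  have hχ : ∀ h x, χ h x = χ₀ (α h⁻¹ x) := fun _ _ => rfl
  have hχT : ∀ h g, χ h (T g) = (‖χ h (T g)‖ : ℂ) := fun h g => by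
    rw [← character_abs, CFC.abs_of_nonneg _ (hT.nonneg g)]
  have hsum : ∀ h, HasSum (fun g => ‖χ h (T g)‖) 1 := fun h => by
    have h1 := hT.hasSum.map (χ h) (χ h : A →ₐ[ℂ] ℂ).toContinuousLinearMap.continuous
    convert Complex.hasSum_re h1 using 2 with g
    · exact congrArg Complex.re (hχT h g).symm
    · simp
  refine ⟨fun h g => ‖χ h (T g)‖, fun h g => norm_nonneg _, hsum, fun h g hg => ?_, fun s h => ?_⟩
  · simp only [Function.notMem_support.1 hg, map_zero, norm_zero]
  set X := translate α s T - T with hX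
  -- Summability of `|X(g)|` has to be checked: the `tsum` in `l1Norm` would otherwise default to
  -- `0` and bound nothing.
  have hXfin : (Function.support X).Finite := by
    refine ((hfin.image (s * ·)).union hfin).subset fun g hg => ?_
    by_contra hg'
    rw [Set.mem_union, not_or] at hg'
    refine hg ?_
    have h1 : T (s⁻¹ * g) = 0 := by
      by_contra h0
      exact hg'.1 ⟨s⁻¹ * g, h0, mul_inv_cancel_left s g⟩
    rw [hX, Pi.sub_apply, Function.notMem_support.1 hg'.2, translate, h1, map_zero, sub_zero]
  have hXmem : MemL1 X := by
    refine summable_of_hasFiniteSupport (hXfin.subset fun g hg hg' => hg ?_)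
    change CFC.abs (X g) = 0
    rw [hg', CFC.abs_zero]
  obtain ⟨d, hd, hdle⟩ := exists_hasSum_norm_character (χ (s * h)) hXmem
  have hsh := (Equiv.mulLeft s).hasSum_iff.2 (hsum (s * h))
  refine (abs_sub_one_tsum_sqrt_mul_sqrt_le (fun _ => norm_nonneg _) (fun _ => norm_nonneg _)
    (hsum h) hsh ?_).trans hdle
  convert (Equiv.mulLeft s).hasSum_iff.2 hd using 2 with g
  -- Equivariance: `α_{(sh)⁻¹} α_s = α_{h⁻¹}`, so the translated `T` evaluated at `sg` returns the
  -- density `a_h(g)`.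
  have htr : χ (s * h) (translate α s T (s * g)) = χ h (T g) := by
    rw [hχ, hχ, translate, inv_mul_cancel_left, ← StarAlgEquiv.mul_apply, ← map_mul,
      mul_inv_rev, inv_mul_cancel_right]
  have hsub : χ h (T g) - χ (s * h) (T (s * g)) =
      ((‖χ h (T g)‖ - ‖χ (s * h) (T (s * g))‖ : ℝ) : ℂ) := by
    rw [Complex.ofReal_sub, ← hχT, ← hχT]
  change |‖χ h (T g)‖ - ‖χ (s * h) (T (s * g))‖| =
    ‖χ (s * h) (translate α s T (s * g) - T (s * g))‖
  rw [map_sub, htr, hsub, Complex.norm_real, Real.norm_eq_abs]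

variable {θ : G → G → Circle}

/-- The hypothesis `H` isolates what the approximation argument needs of `ψφ`: linearity,
contractivity and the error on generators. -/
theorem rcp_le_encard_support [Nontrivial A] (hθ : IsCocycle θ) (α : G →* (A ≃⋆ₐ[ℂ] A))
    {T : G → A} (hT : IsNormalized T) (ω : Set (reducedAlgebra θ)) (δ : ℝ)
    (H : ∀ (Ψ : reducedAlgebra θ →ₗ[ℂ] (L2 G →L[ℂ] L2 G)), (∀ x, ‖Ψ x‖ ≤ ‖x‖) →
      (∀ s, ‖Ψ (lamElt θ s) - lam θ s‖ ≤ l1Norm (translate α s T - T)) →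
      ∀ x ∈ ω, ‖Ψ x - x‖ < δ) :
    rcp (reducedAlgebra θ).subtype ω δ ≤ (Function.support T).encard := by
  by_cases hfin : (Function.support T).Finite
  swap
  · rw [Set.encard_eq_top hfin]
    exact le_top
  obtain ⟨a, ha0, hsum, hsupp, hK⟩ := exists_densities α hT hfin
  obtain ⟨n, f, hf, hrange⟩ : ∃ (n : ℕ) (f : Fin n → G), Function.Injective f ∧
      Set.range f = Function.support T := by
    obtain ⟨n, f, hf⟩ := hfin.fin_embedding
    exact ⟨n, f, f.injective, hf⟩
  rw [← hrange] at hsupp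
  have ha1 : ∀ h g, a h g ≤ 1 := fun h g => le_hasSum (hsum h) g fun _ _ => ha0 h _
  have hsum' : ∀ h, ∑ j, a h (f j) = 1 := fun h => by
    refine ((tsum_fintype _).symm.trans (hf.tsum_eq (f := a h) fun g hg => ?_)).trans
      (hsum h).tsum_eq
    by_contra hg'
    exact hg (hsupp h g hg')
  have hcard : (Function.support T).encard = n := by
    rw [← hrange, ← Set.image_univ, hf.encard_image, Set.encard_univ, ENat.card_eq_coe_fintype_card,
      Fintype.card_fin]
  rw [hcard]
  open scoped ComplexOrder in
  let φ := vectorCompression (reducedAlgebra θ).subtype fun j => basisVec (f j)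
  let ψ := rowCompression fun j => sqrtOp θ ha1 (f j)
  have hφ : ∀ x, ‖φ x‖ ≤ ‖x‖ :=
    norm_vectorCompression_le _ (orthonormal_basisVec.comp f hf)
  have hψ : ∀ m, ‖ψ m‖ ≤ ‖m‖ :=
    norm_rowCompression_le _ (sum_star_sqrtOp_mul_sqrtOp ha0 ha1 hsum')
  refine le_trans (sInf_le ⟨CStarMatrix (Fin n) (Fin n) ℂ, inferInstance, inferInstance,
    inferInstance, Module.Finite.equiv (CStarMatrix.ofMatrixₗ (R := ℂ)), φ, ψ, hφ, hψ, ?_, rfl⟩) ?_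
  · refine H (ψ.toLinearMap.comp φ.toLinearMap) (fun x => (hψ _).trans (hφ x)) fun s => ?_
    exact norm_rowCompression_sub_lam_le hθ hf ha1 hsupp _ s (fun i j => rfl) (norm_nonneg _) (hK s)
  · exact_mod_cast cstarRank_cstarMatrix_le n

end Rank

-- Comparison of the two entropies.

universe u

theorem mem_orbitUnion {X : Type*} {f : X → X} {ω : Set X} {n : ℕ} {x : X} :
    x ∈ orbitUnion f ω n ↔ ∃ k < n, ∃ y ∈ ω, f^[k] y = x := by
  simp [orbitUnion]

/-- The pair `ω'`, `δ'` is chosen before `n`, so the comparison of ranks passes through the `limsup`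
and then the suprema. -/
theorem approximationEntropy_mono {X Y : Type*} {r : Set X → ℝ → ℕ∞} {f : X → X}
    {r' : Set Y → ℝ → ℕ∞} {f' : Y → Y}
    (h : ∀ (ω : Finset X) (δ : ℝ), 0 < δ → ∃ (ω' : Finset Y) (δ' : ℝ), 0 < δ' ∧
      ∀ n, r (orbitUnion f ω n) δ ≤ r' (orbitUnion f' ω' n) δ') :
    approximationEntropy r f ≤ approximationEntropy r' f' := by
  refine iSup_le fun ω => iSup_le fun δ => iSup_le fun hδ => ?_
  obtain ⟨ω', δ', hδ', hr⟩ := h ω δ hδ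
  refine le_trans ?_ (le_iSup_of_le ω' (le_iSup_of_le δ' (le_iSup_of_le hδ' le_rfl)))
  refine limsup_le_limsup (Eventually.of_forall fun n => ?_)
  refine EReal.div_le_div_right_of_nonneg (by positivity) (ENNReal.log_monotone ?_)
  exact_mod_cast hr n

variable {G : Type u} [Group G] {θ : G → G → Circle}

/-- A `δ/3` argument: contractivity of `Ψ` handles the remainder `x - y`, linearity the combination
`y` of generators. -/
theorem norm_sub_lt_of_approx {Ψ : reducedAlgebra θ →ₗ[ℂ] (L2 G →L[ℂ] L2 G)}
    (hΨ : ∀ x, ‖Ψ x‖ ≤ ‖x‖) {F : Finset G} {c : G → ℂ} {t : G → G} {x : reducedAlgebra θ}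
    {δ ε : ℝ} (hx : ‖x - ∑ s ∈ F, c s • lamElt θ (t s)‖ < δ / 3)
    (ht : ∀ s ∈ F, ‖Ψ (lamElt θ (t s)) - lam θ (t s)‖ ≤ ε) (hε : (∑ s ∈ F, ‖c s‖) * ε ≤ δ / 3) :
    ‖Ψ x - x‖ < δ := by
  set y := ∑ s ∈ F, c s • lamElt θ (t s) with hy
  have hyc : (y : L2 G →L[ℂ] L2 G) = ∑ s ∈ F, c s • lam θ (t s) := by
    simp [hy, lamElt]
  have h1 : ‖Ψ y - y‖ ≤ δ / 3 := by
    refine le_trans ?_ hε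
    rw [hyc, hy, map_sum, ← Finset.sum_sub_distrib, Finset.sum_mul]
    refine norm_sum_le_of_le _ fun s hs => ?_
    rw [map_smul, ← smul_sub, norm_smul]
    exact mul_le_mul_of_nonneg_left (ht s hs) (norm_nonneg _)
  have h2 : Ψ x - x = Ψ (x - y) + (Ψ y - y) - ((x - y : reducedAlgebra θ) : L2 G →L[ℂ] L2 G) := by
    rw [map_sub, AddSubgroupClass.coe_sub]
    abel
  have h3 : ‖((x - y : reducedAlgebra θ) : L2 G →L[ℂ] L2 G)‖ < δ / 3 := hx
  calc ‖Ψ x - x‖ ≤ ‖Ψ (x - y)‖ + ‖Ψ y - y‖ + ‖((x - y : reducedAlgebra θ) : L2 G →L[ℂ] L2 G)‖ := by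
        rw [h2]
        exact (norm_sub_le _ _).trans (add_le_add_left (norm_add_le _ _) _)
    _ < δ := by linarith [hΨ (x - y)]

theorem exists_rcp_orbitUnion_le_amenableRank (hθ : IsCocycle θ) (γ : G ≃* G)
    (hγ : ∀ g h, θ (γ g) (γ h) = θ g h) (ω : Finset (reducedAlgebra θ)) {δ : ℝ} (hδ : 0 < δ) :
    ∃ (F : Finset G) (δ' : ℝ), 0 < δ' ∧ ∀ n,
      rcp (reducedAlgebra θ).subtype (orbitUnion (inducedAut θ γ hγ) ω n) δ ≤
        amenableRank (orbitUnion γ (F : Set G) n) δ' := by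
  classical
  choose c hc using fun x => exists_norm_sub_sum_lamElt_lt hθ x (ε := δ / 3) (by positivity)
  -- `M` dominates the coefficient sum of every chosen combination; the `+ 1` in the tolerance keeps
  -- the denominator nonzero.
  set M := ∑ x ∈ ω, ∑ s ∈ (c x).support, ‖c x s‖ with hM
  have hM0 : 0 ≤ M := by positivity
  refine ⟨ω.biUnion fun x => (c x).support, δ / (3 * (M + 1)), by positivity, fun n => ?_⟩
  refine le_sInf ?_
  rintro _ ⟨A, _, _, _, _, α, -, rfl⟩
  refine le_sInf ?_
  rintro _ ⟨T, hT, hTδ, rfl⟩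
  refine rcp_le_encard_support hθ α hT _ _ fun Ψ hΨ hlam x hx => ?_
  obtain ⟨k, hk, y, hy, rfl⟩ := mem_orbitUnion.1 hx
  refine norm_sub_lt_of_approx hΨ (F := (c y).support) (c := c y) (t := γ^[k])
    (ε := δ / (3 * (M + 1))) ?_ (fun s hs => ?_) ?_
  -- The approximation of `y` is transported isometrically to `γ̂^k(y)`, with unchanged
  -- coefficients.
  · rw [norm_iterate_inducedAut_sub_le]
    exact hc y
  · refine (hlam _).trans (hTδ _ (mem_orbitUnion.2 ⟨k, hk, s, ?_, rfl⟩)).le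
    exact Finset.mem_coe.2 (Finset.mem_biUnion.2 ⟨y, hy, hs⟩)
  · have hyM : ∑ s ∈ (c y).support, ‖c y s‖ ≤ M :=
      Finset.single_le_sum (f := fun x => ∑ s ∈ (c x).support, ‖c x s‖)
        (fun _ _ => by positivity) hy
    calc (∑ s ∈ (c y).support, ‖c y s‖) * (δ / (3 * (M + 1)))
        ≤ (M + 1) * (δ / (3 * (M + 1))) := by gcongr; linarith
      _ = δ / 3 := by field_simp

end DualEntropy

end

theorem proposition3p3 {G : Type*} [Group G] (hG : DualEntropy.AdmitsAmenableAction G)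
    (θ : G → G → Circle) (hθ : DualEntropy.IsCocycle θ)
    (γ : G ≃* G) (hγ : ∀ g h, θ (γ g) (γ h) = θ g h) :
    DualEntropy.inducedEntropy θ γ hγ ≤ DualEntropy.dualEntropy γ :=
  DualEntropy.approximationEntropy_mono fun ω _ hδ =>
    DualEntropy.exists_rcp_orbitUnion_le_amenableRank hθ γ hγ ω hδ
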